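/- There is an absolute constant $C>0$ such that the following holds. Let $\chi:\mathbb{R}\to\mathbb{R}$ be a measurable function with $\chi(t)=1$ for $t\le 1$ and $\chi(t)\in[0,1]$ for $t>1$, and let $\sigma:\mathbb{R}\to\mathbb{R}$ be the corresponding continuous solution of $$u\,\sigma(u)=\int_0^u \chi(t)\,\sigma(u-t)\,dt\qquad (u>1),\qquad \sigma(u)=1\quad (u\le 1).$$ Then, whenever $1\le v\le u$, $$|\sigma(u)-\sigma(v)|\le C\Big(\frac{u-v}{u}\Big)^{1-\frac1\pi}\Big(1+\log\frac{u}{u-v}\Big),$$ where for $v=u$ the right-hand side is read as its limit $0$. -/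

import Mathlib

/-- The functions `χ` under consideration: `χ` is (Lebesgue) measurable, equal to `1` for `t ≤ 1`,
and takes values in `[0, 1]` for `t > 1`. (For real-valued functions on the line, Lebesgue
measurability is the same as `AEMeasurable` with respect to Lebesgue measure.) -/
structure IsAdmissible (χ : ℝ → ℝ) : Prop where
  measurable : AEMeasurable χ MeasureTheory.volume
  eq_one : ∀ t : ℝ, t ≤ 1 → χ t = 1
  mem_Icc : ∀ t : ℝ, 1 < t → χ t ∈ Set.Icc (0 : ℝ) 1

/-- `σ` is the (continuous) solution of the integral equation
`u σ(u) = ∫₀ᵘ χ(t) σ(u - t) dt` for `u > 1`, with `σ(u) = 1` for `u ≤ 1`. -/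
structure IsSolution (χ σ : ℝ → ℝ) : Prop where
  continuous : Continuous σ
  eq_one : ∀ u : ℝ, u ≤ 1 → σ u = 1
  integral_eq : ∀ u : ℝ, 1 < u → u * σ u = ∫ t in (0 : ℝ)..u, χ t * σ (u - t)

/-!
Write `L(f, s) = ∫₀^∞ f(t) e^{-st} dt`. The integral equation says that `t σ(t)` is the convolution
of `χ` and `σ`, so `-L(σ)' = L(χ) L(σ)`, and hence (`IsSolution.laplace_eq`)
`s L(σ, s) = exp (-∫₁^∞ (1 - χ(v)) / v * e^{-sv} dv)` for `Re s > 0`.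
As `0 ≤ 1 - χ ≤ 1`, the real part of the exponent is largest when `χ` vanishes exactly where
`cos (v Im s) < 0`. The negative part of the cosine has mean value `1 / π` and vanishes for
`v ≤ 1 / |Im s|`, so that `|s L(σ, s)| ≪ (1 + |Im s| / Re s)^{1/π}` (`exists_norm_laplace_le`).

Let `D(t) = σ(t) - σ(t - δ)` with `δ = u - v`, where `σ` is truncated to `(0, ∞)`. Then
`t D(t) = (χ * D)(t) - δ σ(t - δ)` (`IsSolution.mul_increment_eq`). This is used twice. First, it
shows that `u |D(u)| ≤ ∫₀^u |D| + δ`, which reduces the theorem to a bound on average. Second, after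
multiplication by `e^{-at}`, Plancherel's theorem bounds the `L²` norm of `χ * D` by the supremum of
`L(D, s) = (1 - e^{-δs}) L(σ, s)` on `Re s = a` times the `L²` norm of `χ(t) e^{-at}`
(`IsSolution.integral_sq_mul_increment_le`). With `a = 1 / T` and `T ≥ δ` that supremum is
`≪ δ (T / δ)^{1/π}` (`exists_norm_laplace_increment_le`), and the Cauchy-Schwarz inequality gives
`∫_T^{2T} |D| ≪ δ (T / δ)^{1/π}`. These bounds form a geometric series over dyadic `T ≤ u`, so
`∫₀^u |D| ≪ δ (u / δ)^{1/π}` (`exists_integral_abs_increment_le`), and division by `u` yields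
`|σ(u) - σ(v)| ≪ (δ / u)^{1 - 1/π}`. This is the claim without its logarithmic factor, which is at
least `1`.
-/

open MeasureTheory Set Filter Topology FourierTransform Convolution SchwartzMap

/-! ### Plancherel's theorem for integrable functions -/

/-- On `L¹ ∩ L²` the Fourier transform defined by continuity on `L²` is the Fourier integral. Both
define the same tempered distribution. -/
theorem MeasureTheory.MemLp.fourier_toLp_ae_eq {f : ℝ → ℂ} (hf : Integrable f) (hf2 : MemLp f 2) :
    (𝓕 (hf2.toLp f) : Lp (α := ℝ) ℂ 2) =ᵐ[volume] 𝓕 f := by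
  have hcont : Continuous (𝓕 f) :=
    VectorFourier.fourierIntegral_continuous Real.continuous_fourierChar
      (by exact continuous_inner) hf
  refine ae_eq_of_integral_contDiff_smul_eq ?_ hcont.locallyIntegrable ?_
  · exact (Lp.memLp _).locallyIntegrable (by norm_num)
  intro g hg1 hg2
  have hg₁ : HasCompactSupport (Complex.ofRealCLM ∘ g) := hg2.comp_left rfl
  have hg₂ : ContDiff ℝ (⊤ : ℕ∞) (Complex.ofRealCLM ∘ g) := by fun_prop
  set G : 𝓢(ℝ, ℂ) := hg₁.toSchwartzMap hg₂ with hG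
  have hGg : ∀ x, G x = (g x : ℂ) := fun x => rfl
  have h1 := congrArg (fun T : 𝓢'(ℝ, ℂ) => T G)
    (Lp.fourier_toTemperedDistribution_eq (hf2.toLp f))
  simp only [TemperedDistribution.fourier_apply, Lp.toTemperedDistribution_apply] at h1
  have h2 : ∫ x, (𝓕 G) x • (hf2.toLp f : ℝ → ℂ) x = ∫ x, (𝓕 G) x • f x := by
    refine integral_congr_ae ?_
    filter_upwards [hf2.coeFn_toLp] with x hx
    rw [hx]
  have h3 : ∫ ξ, 𝓕 (G : ℝ → ℂ) ξ • f ξ = ∫ x, G x • 𝓕 f x := by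
    simpa using! (VectorFourier.integral_fourierIntegral_smul_eq_flip (L := innerₗ ℝ)
      Real.continuous_fourierChar continuous_inner G.integrable hf)
  rw [h2, fourier_coe, h3] at h1
  simp only [hGg] at h1
  simpa using h1.symm

theorem memLp_fourier {f : ℝ → ℂ} (hf : Integrable f) (hf2 : MemLp f 2) :
    MemLp (𝓕 f) 2 :=
  (memLp_congr_ae (MemLp.fourier_toLp_ae_eq hf hf2)).1 (Lp.memLp _)

/-- **Plancherel's theorem** for the Fourier integral of a function in `L¹ ∩ L²`. -/
theorem eLpNorm_fourier_eq {f : ℝ → ℂ} (hf : Integrable f) (hf2 : MemLp f 2) :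
    eLpNorm (𝓕 f) 2 = eLpNorm f 2 := by
  rw [← eLpNorm_congr_ae (MemLp.fourier_toLp_ae_eq hf hf2), ← eLpNorm_congr_ae hf2.coeFn_toLp]
  have h := Lp.norm_fourier_eq (hf2.toLp f)
  rwa [Lp.norm_def, Lp.norm_def, ENNReal.toReal_eq_toReal_iff' (Lp.eLpNorm_ne_top _)
    (Lp.eLpNorm_ne_top _)] at h

theorem integral_norm_sq_eq_eLpNorm {f : ℝ → ℂ} (hf2 : MemLp f 2) :
    ∫ x, ‖f x‖ ^ 2 = (eLpNorm f 2).toReal ^ 2 := by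
  rw [hf2.eLpNorm_eq_integral_rpow_norm (by norm_num) (by norm_num)]
  have h0 : 0 ≤ ∫ x, ‖f x‖ ^ 2 := integral_nonneg fun x => by positivity
  rw [ENNReal.toReal_ofReal (by positivity)]
  simp only [ENNReal.toReal_ofNat, Real.rpow_ofNat]
  rw [← Real.rpow_natCast, ← Real.rpow_mul h0]
  norm_num

/-- Convolution with `g` has `L²` operator norm at most `sup |𝓕 g|`. -/
theorem integral_norm_sq_convolution_le {f g : ℝ → ℂ} {M : ℝ} (hf : Integrable f)
    (hf2 : MemLp f 2) (hg : Integrable g)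
    (hfg : MemLp (f ⋆[ContinuousLinearMap.mul ℂ ℂ] g) 2) (hM : ∀ ξ, ‖𝓕 g ξ‖ ≤ M) :
    ∫ x, ‖(f ⋆[ContinuousLinearMap.mul ℂ ℂ] g) x‖ ^ 2 ≤ M ^ 2 * ∫ x, ‖f x‖ ^ 2 := by
  have hM0 : 0 ≤ M := (norm_nonneg _).trans (hM 0)
  have hint : Integrable (f ⋆[ContinuousLinearMap.mul ℂ ℂ] g) := hf.integrable_convolution _ hg
  rw [integral_norm_sq_eq_eLpNorm hfg, integral_norm_sq_eq_eLpNorm hf2, ← mul_pow,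
    ← eLpNorm_fourier_eq hint hfg, ← eLpNorm_fourier_eq hf hf2]
  gcongr
  have h := eLpNorm_le_mul_eLpNorm_of_ae_le_mul (μ := volume) (p := 2) (c := M)
    (f := 𝓕 (f ⋆[ContinuousLinearMap.mul ℂ ℂ] g)) (g := 𝓕 f)
    (Filter.Eventually.of_forall fun ξ => by
      rw [Real.fourier_mul_convolution_eq hf hg, norm_mul, mul_comm]
      gcongr
      exact hM ξ)
  have h' := ENNReal.toReal_mono (ENNReal.mul_ne_top ENNReal.ofReal_ne_top
    (memLp_fourier hf hf2).eLpNorm_ne_top) h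
  rwa [ENNReal.toReal_mul, ENNReal.toReal_ofReal hM0] at h'

/-! ### The Laplace transform of a solution -/

theorem IsAdmissible.mem_Icc_zero_one {χ : ℝ → ℝ} (hχ : IsAdmissible χ) (t : ℝ) :
    χ t ∈ Icc (0 : ℝ) 1 := by
  rcases le_or_gt t 1 with h | h
  · simp [hχ.eq_one t h]
  · exact hχ.mem_Icc t h

theorem IsAdmissible.abs_le_one {χ : ℝ → ℝ} (hχ : IsAdmissible χ) (t : ℝ) : |χ t| ≤ 1 := by
  have := hχ.mem_Icc_zero_one t
  exact abs_le.2 ⟨by linarith [this.1], this.2⟩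

/-- The integral equation also holds on `[0, 1]`, where both sides equal `u`. -/
theorem IsSolution.mul_eq_integral {χ σ : ℝ → ℝ} (hχ : IsAdmissible χ) (hσ : IsSolution χ σ) {u : ℝ}
    (hu : 0 ≤ u) : u * σ u = ∫ t in (0 : ℝ)..u, χ t * σ (u - t) := by
  rcases le_or_gt u 1 with h | h
  · have : ∫ t in (0 : ℝ)..u, χ t * σ (u - t) = ∫ t in (0 : ℝ)..u, (1 : ℝ) := by
      refine intervalIntegral.integral_congr fun t ht => ?_
      rw [uIcc_of_le hu] at ht
      rw [hχ.eq_one t (by linarith [ht.2]), hσ.eq_one (u - t) (by linarith [ht.1]), one_mul]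
    rw [this, hσ.eq_one u h]
    simp
  · exact hσ.integral_eq u h

/-- A maximum of `|σ|` that exceeds `1` would contradict the integral equation at that point. -/
theorem IsSolution.abs_le_one {χ σ : ℝ → ℝ} (hχ : IsAdmissible χ) (hσ : IsSolution χ σ) (t : ℝ) :
    |σ t| ≤ 1 := by
  rcases le_or_gt t 1 with h | h
  · simp [hσ.eq_one t h]
  obtain ⟨w, hw, hmax⟩ := isCompact_Icc.exists_isMaxOn (nonempty_Icc.2 h.le)
    (hσ.continuous.abs.continuousOn (s := Icc 1 t))
  set m := |σ w| with hm
  have hle : |σ t| ≤ m := hmax ⟨h.le, le_rfl⟩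
  have h1 : 1 ≤ m := by
    have := hmax (show (1 : ℝ) ∈ Icc 1 t from ⟨le_rfl, h.le⟩)
    simpa [hσ.eq_one 1 le_rfl] using this
  have hall : ∀ r ≤ t, |σ r| ≤ m := fun r hr => by
    rcases le_or_gt r 1 with h' | h'
    · simpa [hσ.eq_one r h'] using h1
    · exact hmax ⟨h'.le, hr⟩
  -- Near `r = w` the integrand is at most `1`, so the integral over `[0, w]` is at most
  -- `1 + (w - 1) m`.
  have hw0 : 0 ≤ w := by linarith [hw.1]
  have key : w * m ≤ (w - 1) * m + 1 := by
    have e := hσ.mul_eq_integral hχ hw0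
    have habs : w * m = ‖∫ r in (0 : ℝ)..w, χ r * σ (w - r)‖ := by
      rw [← e, Real.norm_eq_abs, abs_mul, abs_of_nonneg hw0]
    rw [habs]
    have hb : ∀ r ∈ Ioc (0 : ℝ) w, ‖χ r * σ (w - r)‖ ≤
        m + (Ioc (w - 1) w).indicator (fun _ => 1 - m) r := fun r hr => by
      have hχ1 := hχ.abs_le_one r
      rw [norm_mul, Real.norm_eq_abs, Real.norm_eq_abs]
      by_cases hr1 : r ∈ Ioc (w - 1) w
      · rw [indicator_of_mem hr1, hσ.eq_one (w - r) (by linarith [hr1.1])]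
        simpa using hχ1
      · rw [indicator_of_notMem hr1]
        have := hall (w - r) (by linarith [hr.1, hw.2])
        nlinarith [abs_nonneg (σ (w - r)), abs_nonneg (χ r)]
    have hi : Integrable ((Ioc (w - 1) w).indicator (fun _ : ℝ => 1 - m)) :=
      (integrable_indicator_iff measurableSet_Ioc).2 (by simp)
    calc _ ≤ ∫ r in (0 : ℝ)..w, (m + (Ioc (w - 1) w).indicator (fun _ => 1 - m) r) :=
          intervalIntegral.norm_integral_le_of_norm_le hw0
            (ae_of_all _ fun r hr => hb r hr)
            (intervalIntegrable_const.add hi.intervalIntegrable)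
      _ = w * m + (1 - m) := by
          rw [intervalIntegral.integral_add intervalIntegrable_const hi.intervalIntegrable,
            intervalIntegral.integral_of_le hw0 (f := (Ioc (w - 1) w).indicator _),
            setIntegral_indicator measurableSet_Ioc,
            inter_eq_self_of_subset_right (Ioc_subset_Ioc_left (by linarith [hw.1]))]
          simp
      _ = _ := by ring
  linarith

/-- The Laplace transform `∫₀^∞ f(t) e^{-st} dt`; the values of `f` on `(-∞, 0]` are ignored. -/
noncomputable def laplace (f : ℝ → ℝ) (s : ℂ) : ℂ :=
  ∫ t in Ioi (0 : ℝ), (f t : ℂ) * Complex.exp (-s * t)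

theorem norm_exp_neg_mul (s : ℂ) (t : ℝ) : ‖Complex.exp (-s * t)‖ = Real.exp (-(s.re * t)) := by
  simp [Complex.norm_exp]

theorem integrableOn_exp_neg_mul {a : ℝ} (ha : 0 < a) (c : ℝ) :
    IntegrableOn (fun t : ℝ => Real.exp (-(a * t))) (Ioi c) := by
  simpa [neg_mul] using exp_neg_integrableOn_Ioi c ha

theorem integral_exp_neg_mul {a : ℝ} (ha : 0 < a) (c : ℝ) :
    ∫ t in Ioi c, Real.exp (-(a * t)) = Real.exp (-(a * c)) / a := by
  have := integral_exp_mul_Ioi (a := -a) (by linarith) c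
  simp only [neg_mul] at this
  rw [this, neg_div_neg_eq]

theorem aestronglyMeasurable_laplace_integrand {f : ℝ → ℝ} (hf : AEMeasurable f) (s : ℂ) :
    AEStronglyMeasurable (fun t : ℝ => (f t : ℂ) * Complex.exp (-s * t))
      (volume.restrict (Ioi 0)) := by
  refine AEStronglyMeasurable.mul ?_ (by fun_prop)
  exact (Complex.measurable_ofReal.comp_aemeasurable hf).aestronglyMeasurable.restrict

theorem integrableOn_laplace {f : ℝ → ℝ} {C : ℝ} (hf : AEMeasurable f)
    (hC : ∀ t, 0 < t → |f t| ≤ C) {s : ℂ} (hs : 0 < s.re) :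
    IntegrableOn (fun t : ℝ => (f t : ℂ) * Complex.exp (-s * t)) (Ioi 0) := by
  refine Integrable.mono' ((integrableOn_exp_neg_mul hs 0).const_mul C)
    (aestronglyMeasurable_laplace_integrand hf s) ?_
  refine (ae_restrict_mem measurableSet_Ioi).mono fun t ht => ?_
  rw [norm_mul, norm_exp_neg_mul, Complex.norm_real, Real.norm_eq_abs]
  gcongr
  exact hC t ht

theorem hasDerivAt_laplace {f : ℝ → ℝ} {C : ℝ} (hf : AEMeasurable f)
    (hC : ∀ t, 0 < t → |f t| ≤ C) {s : ℂ} (hs : 0 < s.re) :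
    HasDerivAt (laplace f) (-laplace (fun t => t * f t) s) s := by
  have hC0 : 0 ≤ C := (abs_nonneg _).trans (hC 1 one_pos)
  set b := s.re / 2 with hb
  have hb0 : 0 < b := by positivity
  have hnhds : {z : ℂ | b < z.re} ∈ 𝓝 s :=
    (isOpen_lt continuous_const Complex.continuous_re).mem_nhds (by simp [hb]; linarith)
  have h := hasDerivAt_integral_of_dominated_loc_of_deriv_le (μ := volume.restrict (Ioi (0 : ℝ)))
    (F := fun (z : ℂ) (t : ℝ) => (f t : ℂ) * Complex.exp (-z * t))
    (F' := fun (z : ℂ) (t : ℝ) => (f t : ℂ) * (Complex.exp (-z * t) * (-t)))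
    (bound := fun t => (C * (2 / b)) * Real.exp (-((b / 2) * t)))
    hnhds (Eventually.of_forall fun z => aestronglyMeasurable_laplace_integrand hf z)
    (integrableOn_laplace hf hC hs) ?_ ?_ ?_ ?_
  · have e : -laplace (fun t => t * f t) s = ∫ t in Ioi (0 : ℝ),
        (f t : ℂ) * (Complex.exp (-s * t) * (-t)) := by
      rw [laplace, ← integral_neg]
      refine integral_congr_ae (ae_of_all _ fun t => ?_)
      simp only [Complex.ofReal_mul]
      ring
    rw [e]
    exact h.2
  · refine AEStronglyMeasurable.mul ?_ (by fun_prop)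
    exact (Complex.measurable_ofReal.comp_aemeasurable hf).aestronglyMeasurable.restrict
  · refine (ae_restrict_mem measurableSet_Ioi).mono fun t (ht : 0 < t) z (hz : b < z.re) => ?_
    rw [norm_mul, norm_mul, norm_exp_neg_mul, Complex.norm_real, Real.norm_eq_abs, norm_neg,
      Complex.norm_real, Real.norm_of_nonneg ht.le, mul_assoc]
    refine mul_le_mul (hC t ht) ?_ (by positivity) hC0
    have h1 : Real.exp (-(z.re * t)) ≤ Real.exp (-(b * t)) := by gcongr
    have h2 : b / 2 * t ≤ Real.exp (b / 2 * t) := by linarith [Real.add_one_le_exp (b / 2 * t)]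
    have h3 : t ≤ 2 / b * Real.exp (b / 2 * t) := by
      calc t = 2 / b * (b / 2 * t) := by field_simp
        _ ≤ _ := by gcongr
    calc _ ≤ Real.exp (-(b * t)) * (2 / b * Real.exp (b / 2 * t)) := by gcongr
      _ = 2 / b * (Real.exp (-(b * t)) * Real.exp (b / 2 * t)) := by ring
      _ = _ := by rw [← Real.exp_add]; ring_nf
  · exact (integrableOn_exp_neg_mul (by positivity) 0).const_mul _
  · refine ae_of_all _ fun t z _ => ?_
    have h0 : HasDerivAt (fun z : ℂ => -z * (t : ℂ)) (-(t : ℂ)) z := by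
      simpa using ((hasDerivAt_id z).neg.mul_const (t : ℂ))
    exact h0.cexp.const_mul _

theorem norm_laplace_le_of_eq_zero {f : ℝ → ℝ} {C : ℝ} (hC : ∀ t, 1 < t → |f t| ≤ C)
    (h0 : ∀ t, t ≤ 1 → f t = 0) {s : ℂ} (hs : 0 < s.re) :
    ‖laplace f s‖ ≤ C * Real.exp (-s.re) / s.re := by
  have e : laplace f s = ∫ t in Ioi (1 : ℝ), (f t : ℂ) * Complex.exp (-s * t) := by
    refine setIntegral_eq_of_subset_of_forall_sdiff_eq_zero measurableSet_Ioi
      (Ioi_subset_Ioi zero_le_one) fun t ht => ?_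
    rw [h0 t (not_lt.1 ht.2)]
    simp
  rw [e]
  calc _ ≤ ∫ t in Ioi (1 : ℝ), C * Real.exp (-(s.re * t)) := by
        refine norm_integral_le_of_norm_le ((integrableOn_exp_neg_mul hs 1).const_mul C) ?_
        refine (ae_restrict_mem measurableSet_Ioi).mono fun t ht => ?_
        rw [norm_mul, norm_exp_neg_mul, Complex.norm_real, Real.norm_eq_abs]
        gcongr
        exact hC t ht
    _ = _ := by rw [integral_const_mul, integral_exp_neg_mul hs, mul_one, mul_div_assoc]

theorem laplace_one {s : ℂ} (hs : 0 < s.re) : laplace (fun _ => 1) s = 1 / s := by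
  have := integral_exp_mul_complex_Ioi (a := -s) (by simpa using hs) 0
  simp only [laplace, Complex.ofReal_one, one_mul, this]
  simp

theorem laplace_sub {f g : ℝ → ℝ} {C C' : ℝ} (hf : AEMeasurable f) (hg : AEMeasurable g)
    (hC : ∀ t, 0 < t → |f t| ≤ C) (hC' : ∀ t, 0 < t → |g t| ≤ C') {s : ℂ} (hs : 0 < s.re) :
    laplace (fun t => f t - g t) s = laplace f s - laplace g s := by
  simp only [laplace]
  rw [← integral_sub (integrableOn_laplace hf hC hs) (integrableOn_laplace hg hC' hs)]
  simp [sub_mul]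

theorem laplace_congr {f g : ℝ → ℝ} (h : ∀ t, 0 < t → f t = g t) (s : ℂ) :
    laplace f s = laplace g s :=
  setIntegral_congr_fun measurableSet_Ioi fun t ht => by simp only [h t ht]

/-- The integral equation says that `t σ(t)` is the convolution of `χ` and `σ` on `(0, ∞)`. -/
theorem IsSolution.laplace_mul_self {χ σ : ℝ → ℝ} (hχ : IsAdmissible χ) (hσ : IsSolution χ σ)
    {s : ℂ} (hs : 0 < s.re) :
    laplace (fun t => t * σ t) s = laplace χ s * laplace σ s := by
  have h := integral_posConvolution (μ := volume) (ν := volume)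
    (integrableOn_laplace hχ.measurable (fun t _ => hχ.abs_le_one t) hs)
    (integrableOn_laplace hσ.continuous.aemeasurable (fun t _ => hσ.abs_le_one hχ t) hs)
    (ContinuousLinearMap.mul ℝ ℂ)
  rw [ContinuousLinearMap.mul_apply'] at h
  rw [laplace, laplace, laplace, ← h]
  refine setIntegral_congr_fun measurableSet_Ioi fun t (ht : 0 < t) => ?_
  simp only [ContinuousLinearMap.mul_apply']
  rw [hσ.mul_eq_integral hχ ht.le, ← intervalIntegral.integral_ofReal,
    ← intervalIntegral.integral_mul_const]
  refine intervalIntegral.integral_congr fun r _ => ?_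
  simp only [Complex.ofReal_mul, Complex.ofReal_sub]
  rw [mul_mul_mul_comm, ← Complex.exp_add]
  ring_nf

theorem IsAdmissible.abs_one_sub_div_le {χ : ℝ → ℝ} (hχ : IsAdmissible χ) (t : ℝ) :
    |(1 - χ t) / t| ≤ 1 := by
  rcases le_or_gt t 1 with h | h
  · simp [hχ.eq_one t h]
  · have := hχ.mem_Icc t h
    rw [abs_of_nonneg (div_nonneg (by linarith [this.2]) (by linarith)), div_le_one (by linarith)]
    linarith [this.1]

/-- The equation `-(d/ds) L(σ) = L(tσ) = L(χ) L(σ)` determines `L(σ)` in terms of `χ`: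
the logarithmic derivative of `s L(σ)` is `1/s - L(χ) = L(1 - χ)`, and `s L(σ) → 1` as
`s → +∞`. -/
theorem IsSolution.laplace_eq {χ σ : ℝ → ℝ} (hχ : IsAdmissible χ) (hσ : IsSolution χ σ) {s : ℂ}
    (hs : 0 < s.re) :
    s * laplace σ s = Complex.exp (-laplace (fun t => (1 - χ t) / t) s) := by
  set J := laplace (fun t => (1 - χ t) / t) with hJ
  set H : ℂ → ℂ := fun z => z * laplace σ z * Complex.exp (J z) with hH
  have hJm : AEMeasurable (fun t => (1 - χ t) / t) :=
    (aemeasurable_const.sub hχ.measurable).div aemeasurable_id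
  have hσb : ∀ t, 0 < t → |σ t| ≤ 1 := fun t _ => hσ.abs_le_one hχ t
  have hder : ∀ z : ℂ, 0 < z.re → HasDerivAt H 0 z := fun z hz => by
    have hz0 : z ≠ 0 := fun h => by simp [h] at hz
    have h1 := hasDerivAt_laplace hσ.continuous.aemeasurable hσb hz
    have h2 := hasDerivAt_laplace hJm (fun t _ => hχ.abs_one_sub_div_le t) hz
    rw [hσ.laplace_mul_self hχ hz] at h1
    have e : laplace (fun t => t * ((1 - χ t) / t)) z = 1 / z - laplace χ z := by
      rw [← laplace_one hz, ← laplace_sub aemeasurable_const hχ.measurable (C := 1) (C' := 1)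
        (fun t _ => by simp) (fun t _ => hχ.abs_le_one t) hz]
      refine laplace_congr (fun t ht => ?_) z
      field_simp
    rw [e] at h2
    refine (((hasDerivAt_id' z).mul h1).mul h2.cexp).congr_deriv ?_
    simp only [Pi.mul_apply]
    field_simp
    ring
  have hconst : ∀ a : ℝ, 0 < a → H s = H a := fun a ha => by
    have hopen : IsOpen {z : ℂ | 0 < z.re} := isOpen_lt continuous_const Complex.continuous_re
    exact hopen.is_const_of_deriv_eq_zero (convex_halfSpace_re_gt 0).isPreconnected
      (fun z hz => (hder z hz).differentiableAt.differentiableWithinAt)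
      (fun z hz => (hder z hz).deriv) hs (by simpa using ha)
  have hexp : Tendsto (fun a : ℝ => Real.exp (-a)) atTop (𝓝 0) :=
    Real.tendsto_exp_neg_atTop_nhds_zero
  have hlim1 : Tendsto (fun a : ℝ => (a : ℂ) * laplace σ a) atTop (𝓝 1) := by
    rw [tendsto_iff_norm_sub_tendsto_zero]
    refine squeeze_zero' (Eventually.of_forall fun _ => norm_nonneg _) ?_
      (by simpa using hexp.const_mul 2)
    filter_upwards [eventually_gt_atTop 0] with a ha
    have ha' : 0 < (a : ℂ).re := by simpa using ha
    have h := norm_laplace_le_of_eq_zero (f := fun t => σ t - 1) (C := 2)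
      (fun t _ => (abs_sub _ _).trans (by rw [abs_one]; linarith [hσ.abs_le_one hχ t]))
      (fun t ht => by simp [hσ.eq_one t ht]) ha'
    rw [laplace_sub hσ.continuous.aemeasurable aemeasurable_const (C' := 1) hσb
      (fun t _ => by simp) ha', laplace_one ha', Complex.ofReal_re] at h
    have ha0 : (a : ℂ) ≠ 0 := by exact_mod_cast ha.ne'
    have e : (a : ℂ) * laplace σ a - 1 = a * (laplace σ a - 1 / a) := by field_simp
    rw [e, norm_mul, Complex.norm_real, Real.norm_of_nonneg ha.le]
    calc _ ≤ a * (2 * Real.exp (-a) / a) := by gcongr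
      _ = _ := by field_simp
  have hlim2 : Tendsto (fun a : ℝ => J a) atTop (𝓝 0) := by
    rw [tendsto_zero_iff_norm_tendsto_zero]
    refine squeeze_zero' (Eventually.of_forall fun _ => norm_nonneg _) ?_ hexp
    filter_upwards [eventually_ge_atTop 1] with a ha
    have h := norm_laplace_le_of_eq_zero (f := fun t => (1 - χ t) / t) (C := 1)
      (fun t _ => hχ.abs_one_sub_div_le t) (fun t ht => by simp [hχ.eq_one t ht])
      (s := a) (by simp; linarith)
    refine h.trans ?_
    rw [Complex.ofReal_re, one_mul]
    exact div_le_self (Real.exp_pos _).le ha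
  have hlim : Tendsto (fun a : ℝ => H a) atTop (𝓝 1) := by
    simpa using hlim1.mul ((Complex.continuous_exp.tendsto 0).comp hlim2)
  have hs1 : H s = 1 :=
    tendsto_nhds_unique (tendsto_const_nhds.congr' (by
      filter_upwards [eventually_gt_atTop 0] with a ha using hconst a ha)) hlim
  rw [Complex.exp_neg]
  exact eq_inv_of_mul_eq_one_left hs1

/-! ### The mean value of the negative part of the cosine -/

/-- The negative part of the cosine. -/
noncomputable def negCos (x : ℝ) : ℝ := max 0 (-Real.cos x)

theorem continuous_negCos : Continuous negCos := by
  unfold negCos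
  fun_prop

theorem negCos_nonneg (x : ℝ) : 0 ≤ negCos x := le_max_left _ _

theorem neg_cos_le_negCos (x : ℝ) : -Real.cos x ≤ negCos x := le_max_right _ _

theorem periodic_negCos : Function.Periodic negCos (2 * Real.pi) := fun x => by
  simp [negCos]

theorem integral_negCos_period (x : ℝ) : ∫ t in x..x + 2 * Real.pi, negCos t = 2 := by
  have hpi := Real.pi_pos
  rw [periodic_negCos.intervalIntegral_add_eq x (-(Real.pi / 2)),
    ← intervalIntegral.integral_add_adjacent_intervals (b := Real.pi / 2)
      (continuous_negCos.intervalIntegrable _ _) (continuous_negCos.intervalIntegrable _ _)]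
  have h1 : ∫ t in -(Real.pi / 2)..Real.pi / 2, negCos t =
      ∫ t in -(Real.pi / 2)..Real.pi / 2, 0 := by
    refine intervalIntegral.integral_congr fun t ht => ?_
    rw [uIcc_of_le (by linarith)] at ht
    exact max_eq_left (by linarith [Real.cos_nonneg_of_mem_Icc ht])
  have h2 : ∫ t in Real.pi / 2..-(Real.pi / 2) + 2 * Real.pi, negCos t =
      ∫ t in Real.pi / 2..-(Real.pi / 2) + 2 * Real.pi, -Real.cos t := by
    refine intervalIntegral.integral_congr fun t ht => ?_
    rw [uIcc_of_le (by linarith)] at ht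
    refine max_eq_right ?_
    linarith [Real.cos_nonpos_of_pi_div_two_le_of_le ht.1 (by linarith [ht.2])]
  rw [h1, h2, intervalIntegral.integral_neg, integral_cos, Real.sin_add_two_pi]
  simp
  norm_num

/-- The mean value of `negCos` is `1 / π`, so `negCos - 1 / π` has a bounded primitive. -/
theorem exists_primitive_negCos : ∃ (P : ℝ → ℝ) (B : ℝ), 0 ≤ B ∧
    (∀ x, HasDerivAt P (negCos x - 1 / Real.pi) x) ∧ ∀ x, -B ≤ P x ∧ P x ≤ 0 := by
  have hpi := Real.pi_pos
  have hc : Continuous fun x => negCos x - 1 / Real.pi := continuous_negCos.sub continuous_const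
  set Q : ℝ → ℝ := fun x => ∫ t in (0 : ℝ)..x, (negCos t - 1 / Real.pi) with hQ
  have hder : ∀ x, HasDerivAt Q (negCos x - 1 / Real.pi) x := fun x =>
    hc.integral_hasStrictDerivAt 0 x |>.hasDerivAt
  have hper : Function.Periodic Q (2 * Real.pi) := fun x => by
    simp only [hQ]
    rw [← intervalIntegral.integral_add_adjacent_intervals (b := x)
      (hc.intervalIntegrable _ _) (hc.intervalIntegrable _ _), add_eq_left,
      intervalIntegral.integral_sub (continuous_negCos.intervalIntegrable _ _)
      intervalIntegrable_const, integral_negCos_period]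
    simp
  have hcont : Continuous Q := continuous_iff_continuousAt.2 fun x => (hder x).continuousAt
  obtain ⟨B, hB⟩ := isCompact_Icc.exists_bound_of_continuousOn
    (hcont.continuousOn (s := Icc 0 (2 * Real.pi)))
  have hB' : ∀ x, |Q x| ≤ B := fun x => by
    obtain ⟨y, hy, hxy⟩ := hper.exists_mem_Ico₀ (by positivity) x
    rw [hxy]
    exact hB y (Ico_subset_Icc_self hy)
  have hB0 : 0 ≤ B := (abs_nonneg _).trans (hB' 0)
  refine ⟨fun x => Q x - B, 2 * B, by positivity, fun x => (hder x).sub_const B, fun x => ?_⟩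
  have := abs_le.1 (hB' x)
  constructor <;> linarith [this.1, this.2]

/-- Replacing `negCos (y * v)` by its mean value `1 / π` costs a bounded amount, uniformly in
`a` and `y`, and `∫_{1/y}^∞ e^{-av} / v dv ≤ log (1 + y / a)`. -/
theorem exists_integral_negCos_le : ∃ B : ℝ, 0 ≤ B ∧ ∀ a y : ℝ, 0 < a → 0 < y →
    IntegrableOn (fun v => Real.exp (-(a * v)) / v * negCos (y * v)) (Ioi (1 / y)) ∧
    ∫ v in Ioi (1 / y), Real.exp (-(a * v)) / v * negCos (y * v) ≤
      B + 1 / Real.pi * Real.log (1 + y / a) := by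
  obtain ⟨P, B, hB0, hP, hPB⟩ := exists_primitive_negCos
  refine ⟨B, hB0, fun a y ha hy => ?_⟩
  have hpi := Real.pi_pos
  -- `A` is a primitive of a majorant of the integrand: its first term comes from integrating
  -- `negCos - 1 / π` by parts, its second one majorizes the primitive of `e^{-av} / v`.
  set A : ℝ → ℝ := fun v => Real.exp (-(a * v)) *
    (P (y * v) / (y * v) - 1 / Real.pi * Real.log (1 + 1 / (a * v))) with hA
  set A' : ℝ → ℝ := fun v => Real.exp (-(a * v)) * -a *
      (P (y * v) / (y * v) - 1 / Real.pi * Real.log (1 + 1 / (a * v))) +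
    Real.exp (-(a * v)) * (((negCos (y * v) - 1 / Real.pi) * y * (y * v) - P (y * v) * y) /
      (y * v) ^ 2 - 1 / Real.pi * (-(1 / (v * (a * v + 1))))) with hA'
  have hb : (0 : ℝ) < 1 / y := by positivity
  have hder : ∀ v, 0 < v → HasDerivAt A (A' v) v := fun v hv => by
    have h1 : HasDerivAt (fun v => Real.exp (-(a * v))) (Real.exp (-(a * v)) * -a) v := by
      simpa using (((hasDerivAt_id' v).const_mul a).neg).exp
    have hyv : HasDerivAt (fun v => y * v) y v := by
      simpa using (hasDerivAt_id' v).const_mul y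
    have h2 : HasDerivAt (fun v => P (y * v)) ((negCos (y * v) - 1 / Real.pi) * y) v :=
      (hP (y * v)).comp v hyv
    have h3 := h2.div hyv (by positivity)
    have h4 : HasDerivAt (fun v => 1 + 1 / (a * v)) (-(a / (a * v) ^ 2)) v := by
      have hav : HasDerivAt (fun v => a * v) a v := by
        simpa using (hasDerivAt_id' v).const_mul a
      refine ((hav.inv (by positivity)).const_add 1).congr_of_eventuallyEq ?_ |>.congr_deriv ?_
      · exact Eventually.of_forall fun v => by simp
      · ring
    have h5 := (h4.log (by positivity)).const_mul (1 / Real.pi)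
    refine (h1.mul (h3.sub h5)).congr_deriv ?_
    simp only [hA']
    congr 4
    field_simp
  have hmaj : ∀ v, 0 < v → Real.exp (-(a * v)) / v * negCos (y * v) ≤ A' v := fun v hv => by
    have hlog : 1 / (a * v + 1) ≤ Real.log (1 + 1 / (a * v)) := by
      refine le_trans (le_of_eq ?_)
        (Real.one_sub_inv_le_log_of_pos (x := 1 + 1 / (a * v)) (by positivity))
      field_simp
      ring
    have e : A' v - Real.exp (-(a * v)) / v * negCos (y * v) = Real.exp (-(a * v)) *
        (-P (y * v) * (a / (y * v) + 1 / (y * v ^ 2)) +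
          a / Real.pi * (Real.log (1 + 1 / (a * v)) - 1 / (a * v + 1))) := by
      simp only [hA']
      field_simp
      ring
    have : 0 ≤ A' v - Real.exp (-(a * v)) / v * negCos (y * v) := by
      rw [e]
      have h1 := (hPB (y * v)).2
      have h2 : 0 ≤ -P (y * v) := by linarith
      have h3 := sub_nonneg.2 hlog
      positivity
    linarith
  have hnn : ∀ v, 0 < v → 0 ≤ Real.exp (-(a * v)) / v * negCos (y * v) := fun v hv => by
    have := negCos_nonneg (y * v)
    positivity
  have hcont : ContinuousWithinAt A (Ici (1 / y)) (1 / y) :=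
    (hder _ hb).continuousAt.continuousWithinAt
  have hbound : ∀ v, 1 / y ≤ v → |A v| ≤
      (B + 1 / Real.pi * Real.log (1 + y / a)) * Real.exp (-(a * v)) := fun v hv => by
    have hv0 : 0 < v := hb.trans_le hv
    have hyv : 1 ≤ y * v := by rwa [div_le_iff₀' hy] at hv
    rw [hA]
    simp only
    rw [abs_mul, abs_of_pos (Real.exp_pos _), mul_comm]
    gcongr
    have h1 := hPB (y * v)
    have h2 : -B ≤ P (y * v) / (y * v) := by
      rw [le_div_iff₀ (by positivity)]
      nlinarith
    have h3 : P (y * v) / (y * v) ≤ 0 := div_nonpos_of_nonpos_of_nonneg h1.2 (by positivity)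
    have h4 : 0 ≤ Real.log (1 + 1 / (a * v)) := Real.log_nonneg (by
      have : 0 < 1 / (a * v) := by positivity
      linarith)
    have h5 : Real.log (1 + 1 / (a * v)) ≤ Real.log (1 + y / a) := by
      refine Real.log_le_log (by positivity) ?_
      gcongr 1 + ?_
      rw [div_le_div_iff₀ (by positivity) ha]
      nlinarith
    have h6 : 1 / Real.pi * Real.log (1 + 1 / (a * v)) ≤
        1 / Real.pi * Real.log (1 + y / a) := by gcongr
    have h7 : 0 ≤ 1 / Real.pi * Real.log (1 + 1 / (a * v)) := by positivity
    rw [abs_le]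
    constructor <;> linarith
  have hlim : Tendsto A atTop (𝓝 0) := by
    refine squeeze_zero_norm' ((eventually_ge_atTop (1 / y)).mono fun v hv => hbound v hv) ?_
    have : Tendsto (fun v => Real.exp (-(a * v))) atTop (𝓝 0) :=
      Real.tendsto_exp_neg_atTop_nhds_zero.comp (tendsto_id.const_mul_atTop ha)
    simpa using this.const_mul (B + 1 / Real.pi * Real.log (1 + y / a))
  have hpos : ∀ v ∈ Ioi (1 / y), 0 ≤ A' v := fun v hv =>
    (hnn v (hb.trans hv)).trans (hmaj v (hb.trans hv))
  have hder' : ∀ v ∈ Ioi (1 / y), HasDerivAt A (A' v) v := fun v hv => hder v (hb.trans hv)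
  have hint := integrableOn_Ioi_deriv_of_nonneg hcont hder' hpos hlim
  have hval := integral_Ioi_of_hasDerivAt_of_nonneg hcont hder' hpos hlim
  have hint' : IntegrableOn (fun v => Real.exp (-(a * v)) / v * negCos (y * v))
      (Ioi (1 / y)) := by
    refine hint.mono' ?_ ((ae_restrict_mem measurableSet_Ioi).mono fun v hv => ?_)
    · have := continuous_negCos.measurable
      exact Measurable.aestronglyMeasurable (by fun_prop)
    · rw [Real.norm_of_nonneg (hnn v (hb.trans hv))]
      exact hmaj v (hb.trans hv)
  refine ⟨hint', (setIntegral_mono_on hint' hint measurableSet_Ioi fun v hv =>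
    hmaj v (hb.trans hv)).trans ?_⟩
  rw [hval, zero_sub]
  refine (neg_le_abs _).trans ((hbound _ le_rfl).trans ?_)
  have hl : 0 ≤ Real.log (1 + y / a) := Real.log_nonneg (by
    have : 0 < y / a := by positivity
    linarith)
  refine mul_le_of_le_one_right (by positivity) (Real.exp_le_one_iff.2 ?_)
  have : 0 < a * (1 / y) := by positivity
  linarith

/-- Since `0 ≤ (1 - χ v) / v ≤ 1 / v`, the least favourable `χ` is the one that equals `0` exactly
where `cos (v * Im s)` is negative. -/
theorem exists_neg_re_laplace_le : ∃ B : ℝ, 0 ≤ B ∧ ∀ χ : ℝ → ℝ, IsAdmissible χ →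
    ∀ s : ℂ, 0 < s.re →
      -(laplace (fun t => (1 - χ t) / t) s).re ≤
        B + 1 / Real.pi * Real.log (1 + |s.im| / s.re) := by
  obtain ⟨B, hB0, hB⟩ := exists_integral_negCos_le
  refine ⟨B, hB0, fun χ hχ s hs => ?_⟩
  have hpi := Real.pi_pos
  have hJm : AEMeasurable (fun t => (1 - χ t) / t) :=
    (aemeasurable_const.sub hχ.measurable).div aemeasurable_id
  have hint := integrableOn_laplace hJm (fun t _ => hχ.abs_one_sub_div_le t) hs
  have hre : ∀ t : ℝ, (((1 - χ t) / t : ℝ) * Complex.exp (-s * t) : ℂ).re =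
      (1 - χ t) / t * (Real.exp (-(s.re * t)) * Real.cos (|s.im| * t)) := fun t => by
    rw [Complex.re_ofReal_mul, Complex.exp_re]
    have e : Real.cos (|s.im| * t) = Real.cos (s.im * t) := by
      rcases abs_cases s.im with h | h <;> simp [h.1]
    rw [e]
    simp
  have hJre : -(laplace (fun t => (1 - χ t) / t) s).re = ∫ t in Ioi (0 : ℝ),
      -((1 - χ t) / t * (Real.exp (-(s.re * t)) * Real.cos (|s.im| * t))) := by
    rw [integral_neg]
    congr 1
    refine (integral_re hint).symm.trans (integral_congr_ae (ae_of_all _ fun t => ?_))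
    exact hre t
  have hintre : IntegrableOn (fun t =>
      -((1 - χ t) / t * (Real.exp (-(s.re * t)) * Real.cos (|s.im| * t)))) (Ioi 0) := by
    refine (Integrable.congr (Integrable.re hint) (ae_of_all _ fun t => ?_)).neg
    exact hre t
  have hj : ∀ t, 0 < t → 0 ≤ (1 - χ t) / t ∧ (1 - χ t) / t ≤ 1 / t := fun t ht => by
    have := hχ.mem_Icc_zero_one t
    exact ⟨div_nonneg (by linarith [this.2]) ht.le, by gcongr; linarith [this.1]⟩
  rw [hJre]
  rcases eq_or_ne s.im 0 with h0 | h0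
  · rw [h0]
    simp only [abs_zero, zero_mul, Real.cos_zero, mul_one, zero_div, add_zero, Real.log_one,
      mul_zero]
    refine le_trans ?_ hB0
    refine setIntegral_nonpos measurableSet_Ioi fun t ht => ?_
    have := (hj t ht).1
    have := Real.exp_pos (-(s.re * t))
    simp only [Left.neg_nonpos_iff]
    positivity
  have hy : 0 < |s.im| := abs_pos.2 h0
  obtain ⟨hi, hle⟩ := hB s.re |s.im| hs hy
  refine le_trans ?_ hle
  have hsub : Ioi (1 / |s.im|) ⊆ Ioi 0 := Ioi_subset_Ioi (by positivity)
  rw [← inter_eq_self_of_subset_right hsub, ← setIntegral_indicator measurableSet_Ioi]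
  refine setIntegral_mono_on hintre
    ((integrable_indicator_iff measurableSet_Ioi).2 hi).integrableOn measurableSet_Ioi
    fun t (ht : 0 < t) => ?_
  obtain ⟨hj0, hj1⟩ := hj t ht
  have hE := Real.exp_pos (-(s.re * t))
  by_cases hts : t ∈ Ioi (1 / |s.im|)
  · rw [indicator_of_mem hts]
    have hn := negCos_nonneg (|s.im| * t)
    calc _ = (1 - χ t) / t * (Real.exp (-(s.re * t)) * -Real.cos (|s.im| * t)) := by ring
      _ ≤ 1 / t * (Real.exp (-(s.re * t)) * negCos (|s.im| * t)) := by
        refine (mul_le_mul_of_nonneg_left ?_ hj0).trans (mul_le_mul_of_nonneg_right hj1 ?_)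
        · exact mul_le_mul_of_nonneg_left (neg_cos_le_negCos _) hE.le
        · positivity
      _ = _ := by ring
  · rw [indicator_of_notMem hts]
    -- Below `1 / |s.im|` the cosine is still positive.
    have h1 : |s.im| * t ≤ 1 := by
      have := not_lt.1 (show ¬1 / |s.im| < t from hts)
      rwa [le_div_iff₀' hy] at this
    have hcos : 0 < Real.cos (|s.im| * t) :=
      Real.cos_pos_of_le_one (by rwa [abs_of_pos (by positivity)])
    simp only [Left.neg_nonpos_iff]
    positivity

/-- The transform of a solution satisfies `|s L(σ, s)| ≪ (1 + |Im s| / Re s)^{1/π}`. -/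
theorem exists_norm_laplace_le : ∃ K : ℝ, 0 < K ∧ ∀ χ σ : ℝ → ℝ, IsAdmissible χ →
    IsSolution χ σ → ∀ s : ℂ, 0 < s.re →
      ‖s‖ * ‖laplace σ s‖ ≤ K * (1 + |s.im| / s.re) ^ (1 / Real.pi) := by
  obtain ⟨B, -, hB⟩ := exists_neg_re_laplace_le
  refine ⟨Real.exp B, Real.exp_pos B, fun χ σ hχ hσ s hs => ?_⟩
  rw [← norm_mul, hσ.laplace_eq hχ hs, Complex.norm_exp, Complex.neg_re,
    Real.rpow_def_of_pos (by positivity), ← Real.exp_add]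
  refine Real.exp_le_exp.2 ((hB χ hχ s hs).trans (le_of_eq ?_))
  ring

/-! ### Mean square bounds for increments -/

theorem integrable_and_integral_norm_sq_le_of_exp_bound {f : ℝ → ℂ} {C b : ℝ}
    (hf : AEStronglyMeasurable f) (hb : 0 < b) (h0 : ∀ t ≤ 0, f t = 0)
    (hC : ∀ t, 0 < t → ‖f t‖ ≤ C * Real.exp (-(b * t))) :
    Integrable f ∧ MemLp f 2 ∧ ∫ t, ‖f t‖ ^ 2 ≤ C ^ 2 / (2 * b) := by
  have hg : ∀ (c : ℝ) {B : ℝ}, 0 < c →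
      Integrable ((Ioi (0 : ℝ)).indicator fun t => B * Real.exp (-(c * t))) := fun c B hc =>
    (integrable_indicator_iff measurableSet_Ioi).2 ((integrableOn_exp_neg_mul hc 0).const_mul B)
  have hsq : ∀ t, ‖f t‖ ^ 2 ≤
      (Ioi (0 : ℝ)).indicator (fun t => C ^ 2 * Real.exp (-(2 * b * t))) t := fun t => by
    by_cases ht : 0 < t
    · rw [indicator_of_mem (show t ∈ Ioi 0 from ht)]
      calc ‖f t‖ ^ 2 ≤ (C * Real.exp (-(b * t))) ^ 2 := by gcongr; exact hC t ht
        _ = _ := by rw [mul_pow, ← Real.exp_nat_mul]; push_cast; ring_nf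
    · rw [indicator_of_notMem (show t ∉ Ioi 0 from ht), h0 t (not_lt.1 ht)]
      simp
  have hint2 : Integrable fun t => ‖f t‖ ^ 2 :=
    (hg (2 * b) (by positivity)).mono' (hf.norm.pow 2) (ae_of_all _ fun t => by
      rw [Real.norm_of_nonneg (by positivity)]; exact hsq t)
  refine ⟨(hg b (B := C) hb).mono' hf (ae_of_all _ fun t => ?_),
    (memLp_two_iff_integrable_sq_norm hf).2 hint2, ?_⟩
  · by_cases ht : 0 < t
    · rw [indicator_of_mem (show t ∈ Ioi 0 from ht)]
      exact hC t ht
    · rw [indicator_of_notMem (show t ∉ Ioi 0 from ht), h0 t (not_lt.1 ht)]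
      simp
  · refine (integral_mono hint2 (hg (2 * b) (by positivity)) hsq).trans (le_of_eq ?_)
    rw [integral_indicator measurableSet_Ioi, integral_const_mul,
      integral_exp_neg_mul (by positivity)]
    simp
    ring

/-- The function `t ↦ f t * e^{-at}`, with values in `ℂ`. -/
noncomputable def expDamp (a : ℝ) (f : ℝ → ℝ) (t : ℝ) : ℂ := (f t * Real.exp (-(a * t)) : ℝ)

theorem expDamp_eq (a : ℝ) (f : ℝ → ℝ) (t : ℝ) :
    expDamp a f t = f t * Complex.exp (-(a * t)) := by
  simp [expDamp]

theorem norm_expDamp (a : ℝ) (f : ℝ → ℝ) (t : ℝ) :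
    ‖expDamp a f t‖ = |f t| * Real.exp (-(a * t)) := by
  rw [expDamp, Complex.norm_real, Real.norm_eq_abs, abs_mul, abs_of_pos (Real.exp_pos _)]

theorem aestronglyMeasurable_expDamp (a : ℝ) {f : ℝ → ℝ} (hf : AEMeasurable f) :
    AEStronglyMeasurable (expDamp a f) := by
  refine AEMeasurable.aestronglyMeasurable (Complex.measurable_ofReal.comp_aemeasurable ?_)
  exact hf.mul (by fun_prop)

theorem expDamp_integrable {a C : ℝ} (ha : 0 < a) {f : ℝ → ℝ} (hf : AEMeasurable f)
    (h0 : ∀ t ≤ 0, f t = 0) (hC : ∀ t, |f t| ≤ C) :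
    Integrable (expDamp a f) ∧ MemLp (expDamp a f) 2 ∧
      ∫ t, ‖expDamp a f t‖ ^ 2 ≤ C ^ 2 / (2 * a) := by
  refine integrable_and_integral_norm_sq_le_of_exp_bound (aestronglyMeasurable_expDamp a hf) ha
    (fun t ht => by simp [expDamp, h0 t ht]) fun t _ => ?_
  rw [norm_expDamp]
  gcongr
  exact hC t

/-- The Fourier transform of `f t * e^{-at}` is the Laplace transform of `f` on `Re s = a`. -/
theorem fourier_expDamp (a : ℝ) {f : ℝ → ℝ} (h0 : ∀ t ≤ 0, f t = 0) (ξ : ℝ) :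
    𝓕 (expDamp a f) ξ = laplace f (a + 2 * Real.pi * ξ * Complex.I) := by
  rw [Real.fourier_eq', laplace, ← integral_indicator measurableSet_Ioi]
  refine integral_congr_ae (ae_of_all _ fun t => ?_)
  by_cases ht : 0 < t
  · simp only
    rw [indicator_of_mem (show t ∈ Ioi 0 from ht), expDamp_eq, smul_eq_mul, mul_left_comm,
        ← Complex.exp_add]
    congr 2
    simp
    ring
  · simp only
    rw [indicator_of_notMem (show t ∉ Ioi 0 from ht), expDamp, h0 t (not_lt.1 ht)]
    simp

theorem convolution_expDamp (a : ℝ) (f g : ℝ → ℝ) (t : ℝ) :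
    (expDamp a f ⋆[ContinuousLinearMap.mul ℂ ℂ] expDamp a g) t =
      expDamp a (fun t => ∫ r, f r * g (t - r)) t := by
  rw [convolution_def, expDamp, ← integral_mul_const, ← integral_complex_ofReal]
  refine integral_congr_ae (ae_of_all _ fun r => ?_)
  simp only [ContinuousLinearMap.mul_apply', expDamp]
  rw [← Complex.ofReal_mul, mul_mul_mul_comm, ← Real.exp_add]
  ring_nf

/-- The restriction of `f` to the positive half-line, extended by zero. -/
noncomputable def posTrunc (f : ℝ → ℝ) : ℝ → ℝ := (Ioi 0).indicator f

theorem posTrunc_of_pos {f : ℝ → ℝ} {t : ℝ} (ht : 0 < t) : posTrunc f t = f t :=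
  indicator_of_mem (show t ∈ Ioi 0 from ht) f

theorem posTrunc_of_nonpos {f : ℝ → ℝ} {t : ℝ} (ht : t ≤ 0) : posTrunc f t = 0 :=
  indicator_of_notMem (show t ∉ Ioi 0 from not_lt.2 ht) f

theorem abs_posTrunc_le {f : ℝ → ℝ} {C : ℝ} (hC0 : 0 ≤ C) (hC : ∀ t, |f t| ≤ C) (t : ℝ) :
    |posTrunc f t| ≤ C := by
  rcases le_or_gt t 0 with h | h
  · simpa [posTrunc_of_nonpos h] using hC0
  · simpa [posTrunc_of_pos h] using hC t

/-- The increment `f t - f (t - δ)` of the truncation of `f` to the positive half-line. -/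
noncomputable def increment (f : ℝ → ℝ) (δ t : ℝ) : ℝ := posTrunc f t - posTrunc f (t - δ)

theorem laplace_posTrunc (f : ℝ → ℝ) (s : ℂ) : laplace (posTrunc f) s = laplace f s :=
  laplace_congr (fun _ ht => posTrunc_of_pos ht) s

theorem laplace_posTrunc_sub (f : ℝ → ℝ) {δ : ℝ} (hδ : 0 ≤ δ) (s : ℂ) :
    laplace (fun t => posTrunc f (t - δ)) s = Complex.exp (-(δ * s)) * laplace f s := by
  set G : ℝ → ℂ := fun r => Complex.exp (-(δ * s)) *
    (Ioi (0 : ℝ)).indicator (fun r : ℝ => (f r : ℂ) * Complex.exp (-s * r)) r with hG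
  have h1 : laplace (fun t => posTrunc f (t - δ)) s = ∫ t : ℝ, G (t - δ) := by
    rw [laplace, ← integral_indicator measurableSet_Ioi]
    refine integral_congr_ae (ae_of_all _ fun t => ?_)
    simp only [hG]
    by_cases ht : 0 < t - δ
    · rw [indicator_of_mem (show t ∈ Ioi 0 from by rw [mem_Ioi]; linarith),
        indicator_of_mem (show t - δ ∈ Ioi 0 from ht), posTrunc_of_pos ht, mul_left_comm,
        ← Complex.exp_add]
      congr 2
      push_cast
      ring
    · rw [indicator_of_notMem (show t - δ ∉ Ioi 0 from ht), mul_zero]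
      refine indicator_apply_eq_zero.2 fun _ => ?_
      rw [posTrunc_of_nonpos (not_lt.1 ht)]
      simp
  rw [h1, integral_sub_right_eq_self G δ, integral_const_mul, integral_indicator measurableSet_Ioi,
    laplace]

theorem norm_one_sub_exp_neg_le {z : ℂ} (hz : 0 ≤ z.re) :
    ‖1 - Complex.exp (-z)‖ ≤ 2 ∧ ‖1 - Complex.exp (-z)‖ ≤ 2 * ‖z‖ := by
  have h1 : ‖1 - Complex.exp (-z)‖ ≤ 2 := by
    refine (norm_sub_le _ _).trans ?_
    rw [norm_one, Complex.norm_exp, Complex.neg_re]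
    linarith [Real.exp_le_one_iff.2 (neg_nonpos.2 hz)]
  refine ⟨h1, ?_⟩
  rcases le_or_gt ‖z‖ 1 with h | h
  · rw [norm_sub_rev]
    simpa using Complex.norm_exp_sub_one_le (x := -z) (by simpa using h)
  · linarith

theorem aemeasurable_posTrunc {f : ℝ → ℝ} (hf : AEMeasurable f) : AEMeasurable (posTrunc f) :=
  hf.indicator measurableSet_Ioi

theorem IsSolution.measurable_increment {χ σ : ℝ → ℝ} (hσ : IsSolution χ σ) (δ : ℝ) :
    Measurable (increment σ δ) := by
  have h : Measurable (posTrunc σ) := hσ.continuous.measurable.indicator measurableSet_Ioi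
  exact h.sub (h.comp (measurable_id.sub_const δ))

theorem IsSolution.abs_posTrunc_le_one {χ σ : ℝ → ℝ} (hχ : IsAdmissible χ) (hσ : IsSolution χ σ)
    (t : ℝ) :
    |posTrunc σ t| ≤ 1 :=
  abs_posTrunc_le zero_le_one (hσ.abs_le_one hχ) t

theorem IsSolution.abs_increment_le {χ σ : ℝ → ℝ} (hχ : IsAdmissible χ) (hσ : IsSolution χ σ)
    (δ t : ℝ) :
    |increment σ δ t| ≤ 2 := by
  refine (abs_sub _ _).trans ?_
  linarith [hσ.abs_posTrunc_le_one hχ t, hσ.abs_posTrunc_le_one hχ (t - δ)]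

theorem increment_of_nonpos {f : ℝ → ℝ} {δ t : ℝ} (hδ : 0 ≤ δ) (ht : t ≤ 0) :
    increment f δ t = 0 := by
  rw [increment, posTrunc_of_nonpos ht, posTrunc_of_nonpos (by linarith), sub_zero]

theorem IsSolution.posTrunc_eq_integral {χ σ : ℝ → ℝ} (hχ : IsAdmissible χ) (hσ : IsSolution χ σ)
    (t : ℝ) :
    Integrable (fun r => posTrunc χ r * posTrunc σ (t - r)) ∧
      t * posTrunc σ t = ∫ r, posTrunc χ r * posTrunc σ (t - r) := by
  have hind : (fun r => posTrunc χ r * posTrunc σ (t - r)) =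
      (Ioo 0 t).indicator fun r => χ r * σ (t - r) := by
    ext r
    by_cases h1 : 0 < r
    · by_cases h2 : r < t
      · rw [indicator_of_mem (show r ∈ Ioo 0 t from ⟨h1, h2⟩), posTrunc_of_pos h1,
          posTrunc_of_pos (by linarith)]
      · rw [indicator_of_notMem (fun h => h2 h.2), posTrunc_of_nonpos (f := σ) (by linarith),
          mul_zero]
    · rw [indicator_of_notMem (fun h => h1 h.1), posTrunc_of_nonpos (by linarith), zero_mul]
  rw [hind]
  constructor
  · rw [integrable_indicator_iff measurableSet_Ioo]
    refine Measure.integrableOn_of_bounded (M := 1) (by simp) ?_ (ae_of_all _ fun r => ?_)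
    · have h2 : Continuous fun r => σ (t - r) := hσ.continuous.comp (by fun_prop)
      exact (hχ.measurable.mul h2.aemeasurable).aestronglyMeasurable
    · rw [norm_mul]
      exact mul_le_one₀ (hχ.abs_le_one r) (norm_nonneg _) (hσ.abs_le_one hχ _)
  · rw [integral_indicator measurableSet_Ioo, ← integral_Ioc_eq_integral_Ioo]
    rcases le_or_gt t 0 with h | h
    · rw [posTrunc_of_nonpos h, Ioc_eq_empty (not_lt.2 h)]
      simp
    · rw [posTrunc_of_pos h, hσ.mul_eq_integral hχ h.le, intervalIntegral.integral_of_le h.le]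

/-- The integral equation for increments. Because of the truncation it holds for every real `t`
and every `δ`. -/
theorem IsSolution.mul_increment_eq {χ σ : ℝ → ℝ} (hχ : IsAdmissible χ) (hσ : IsSolution χ σ)
    (δ t : ℝ) :
    t * increment σ δ t =
      (∫ r, posTrunc χ r * increment σ δ (t - r)) - δ * posTrunc σ (t - δ) := by
  obtain ⟨i1, e1⟩ := hσ.posTrunc_eq_integral hχ t
  obtain ⟨i2, e2⟩ := hσ.posTrunc_eq_integral hχ (t - δ)
  have h : ∫ r, posTrunc χ r * increment σ δ (t - r) =
      t * posTrunc σ t - (t - δ) * posTrunc σ (t - δ) := by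
    rw [e1, e2, ← integral_sub i1 i2]
    refine integral_congr_ae (ae_of_all _ fun r => ?_)
    simp only [increment]
    rw [sub_right_comm]
    ring
  rw [h, increment]
  ring

theorem IsSolution.laplace_increment {χ σ : ℝ → ℝ} (hχ : IsAdmissible χ) (hσ : IsSolution χ σ)
    {δ : ℝ}
    (hδ : 0 ≤ δ) {s : ℂ} (hs : 0 < s.re) :
    laplace (increment σ δ) s = (1 - Complex.exp (-(δ * s))) * laplace σ s := by
  have hm : Measurable (posTrunc σ) := hσ.continuous.measurable.indicator measurableSet_Ioi
  have h := laplace_sub (f := posTrunc σ) (g := fun t => posTrunc σ (t - δ))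
    hm.aemeasurable (hm.comp (measurable_id.sub_const δ)).aemeasurable
    (fun t _ => hσ.abs_posTrunc_le_one hχ t) (fun t _ => hσ.abs_posTrunc_le_one hχ _) hs
  rw [laplace_posTrunc, laplace_posTrunc_sub σ hδ] at h
  rw [sub_mul, one_mul, ← h]
  rfl

/-- On the line `Re s = 1 / T` the transform of the increment is bounded using
`|1 - e^{-δs}| ≤ 2 min(1, δ |s|)`; the resulting bound is largest when `|Im s|` is about `1 / δ`. -/
theorem exists_norm_laplace_increment_le : ∃ K : ℝ, 0 < K ∧ ∀ χ σ : ℝ → ℝ, IsAdmissible χ →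
    IsSolution χ σ → ∀ δ T : ℝ, 0 < δ → δ ≤ T → ∀ s : ℂ, s.re = 1 / T →
      ‖laplace (increment σ δ) s‖ ≤ K * δ * (T / δ) ^ (1 / Real.pi) := by
  obtain ⟨K, hK0, hK⟩ := exists_norm_laplace_le
  refine ⟨4 * K, by positivity, fun χ σ hχ hσ δ T hδ hT s hsT => ?_⟩
  have hpi := Real.pi_pos
  have hT0 : 0 < T := hδ.trans_le hT
  have hs : 0 < s.re := by rw [hsT]; positivity
  have hF := hK χ σ hχ hσ s hs
  set F := ‖laplace σ s‖
  have hF0 : 0 ≤ F := norm_nonneg _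
  set p := 1 / Real.pi with hp
  have hp0 : 0 ≤ p := by positivity
  have hp1 : p ≤ 1 := by
    rw [hp, div_le_one hpi]; linarith [Real.pi_gt_three]
  have h2p : (2 : ℝ) ^ p ≤ 2 := by
    simpa using Real.rpow_le_rpow_of_exponent_le (one_le_two) hp1
  rw [hsT, div_div_eq_mul_div, div_one] at hF
  rw [hσ.laplace_increment hχ hδ.le hs, norm_mul]
  obtain ⟨e1, e2⟩ := norm_one_sub_exp_neg_le (z := δ * s) (by
    rw [Complex.re_ofReal_mul]; positivity)
  rw [norm_mul, Complex.norm_real, Real.norm_of_nonneg hδ.le] at e2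
  have hTδ : 1 ≤ T / δ := by rwa [one_le_div hδ]
  -- Use `|1 - e^{-δs}| ≤ 2 δ |s|` when `|Im s| ≤ 1 / δ`, and `|1 - e^{-δs}| ≤ 2` otherwise.
  rcases le_or_gt (|s.im| * δ) 1 with h | h
  · have h1 : 1 + |s.im| * T ≤ 2 * (T / δ) := by
      have : |s.im| * T ≤ T / δ := by
        rw [le_div_iff₀ hδ]; nlinarith
      linarith
    have h2 : (1 + |s.im| * T) ^ p ≤ 2 * (T / δ) ^ p := by
      calc (1 + |s.im| * T) ^ p ≤ (2 * (T / δ)) ^ p := by gcongr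
        _ = 2 ^ p * (T / δ) ^ p := Real.mul_rpow (by norm_num) (by positivity)
        _ ≤ _ := by gcongr
    calc ‖1 - Complex.exp (-(δ * s))‖ * F ≤ 2 * (δ * ‖s‖) * F := by gcongr
      _ = 2 * δ * (‖s‖ * F) := by ring
      _ ≤ 2 * δ * (K * (2 * (T / δ) ^ p)) :=
        mul_le_mul_of_nonneg_left (hF.trans (by gcongr)) (by positivity)
      _ = _ := by ring
  · have hy : 0 < |s.im| := by
      by_contra! h'
      nlinarith
    have h1 : 1 + |s.im| * T ≤ 2 * ((|s.im| * δ) * (T / δ)) := by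
      have e : (|s.im| * δ) * (T / δ) = |s.im| * T := by field_simp
      rw [e]
      nlinarith
    have h2 : (1 + |s.im| * T) ^ p ≤ 2 * ((|s.im| * δ) * (T / δ) ^ p) := by
      calc (1 + |s.im| * T) ^ p ≤ (2 * ((|s.im| * δ) * (T / δ))) ^ p := by gcongr
        _ = 2 ^ p * ((|s.im| * δ) ^ p * (T / δ) ^ p) := by
          rw [Real.mul_rpow (by norm_num) (by positivity),
            Real.mul_rpow (by positivity) (by positivity)]
        _ ≤ _ := by
          gcongr
          simpa using Real.rpow_le_rpow_of_exponent_le h.le hp1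
    have h3 : |s.im| * F ≤ |s.im| * (K * (2 * (δ * (T / δ) ^ p))) := by
      calc |s.im| * F ≤ ‖s‖ * F := by gcongr; exact Complex.abs_im_le_norm s
        _ ≤ K * (2 * ((|s.im| * δ) * (T / δ) ^ p)) := hF.trans (by gcongr)
        _ = _ := by ring
    calc ‖1 - Complex.exp (-(δ * s))‖ * F ≤ 2 * (K * (2 * (δ * (T / δ) ^ p))) := by
          gcongr
          exact le_of_mul_le_mul_left h3 hy
      _ = _ := by ring

/-- Plancherel's theorem turns a bound `M` for the Laplace transform of the increment on the line
`Re s = a` into a mean square bound for `t * increment σ δ t`. -/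
theorem IsSolution.integral_sq_mul_increment_le {χ σ : ℝ → ℝ} (hχ : IsAdmissible χ)
    (hσ : IsSolution χ σ) {δ a M : ℝ} (hδ : 0 ≤ δ) (ha : 0 < a)
    (hM : ∀ s : ℂ, s.re = a → ‖laplace (increment σ δ) s‖ ≤ M) :
    Integrable (fun t => (t * increment σ δ t * Real.exp (-(a * t))) ^ 2) ∧
      ∫ t, (t * increment σ δ t * Real.exp (-(a * t))) ^ 2 ≤ (M ^ 2 + δ ^ 2) / a := by
  set D := increment σ δ with hD
  have hDm : Measurable D := hσ.measurable_increment δ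
  have hD0 : ∀ t ≤ 0, D t = 0 := fun t ht => increment_of_nonpos hδ ht
  have hDb : ∀ t, |D t| ≤ 2 := hσ.abs_increment_le hχ δ
  have hσm : Measurable (posTrunc σ) := hσ.continuous.measurable.indicator measurableSet_Ioi
  set R : ℝ → ℝ := fun t => δ * posTrunc σ (t - δ) with hR
  set Y : ℝ → ℝ := fun t => ∫ r, posTrunc χ r * D (t - r) with hY
  have hYe : ∀ t, t * D t = Y t - R t := fun t => hσ.mul_increment_eq hχ δ t
  obtain ⟨hX1, hX2, hX3⟩ := expDamp_integrable ha (aemeasurable_posTrunc hχ.measurable)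
    (fun t ht => posTrunc_of_nonpos ht) (abs_posTrunc_le zero_le_one hχ.abs_le_one)
  obtain ⟨hD1, -, -⟩ := expDamp_integrable ha hDm.aemeasurable hD0 hDb
  obtain ⟨hR1, hR2, hR3⟩ := expDamp_integrable (f := R) (C := δ) ha
    ((hσm.comp (measurable_id.sub_const δ)).const_mul δ).aemeasurable
    (fun t ht => by simp only [hR]; rw [posTrunc_of_nonpos (by linarith), mul_zero])
    (fun t => by
      rw [abs_mul, abs_of_nonneg hδ]
      exact mul_le_of_le_one_right hδ (hσ.abs_posTrunc_le_one hχ _))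
  -- `t e^{-at} ≤ (2 / a) e^{-at/2}` puts `t D(t) e^{-at}` in `L²`.
  obtain ⟨-, hψ2, -⟩ := integrable_and_integral_norm_sq_le_of_exp_bound
    (f := expDamp a fun t => t * D t) (C := 2 * (2 / a)) (b := a / 2)
    (aestronglyMeasurable_expDamp a (measurable_id.mul hDm).aemeasurable) (by positivity)
    (fun t ht => by simp [expDamp, hD0 t ht]) (fun t ht => by
      rw [norm_expDamp, abs_mul, abs_of_pos ht]
      have h2 : a / 2 * t ≤ Real.exp (a / 2 * t) := by linarith [Real.add_one_le_exp (a / 2 * t)]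
      have h3 : t ≤ 2 / a * Real.exp (a / 2 * t) := by
        calc t = 2 / a * (a / 2 * t) := by field_simp
          _ ≤ _ := by gcongr
      calc t * |D t| * Real.exp (-(a * t)) ≤
            2 / a * Real.exp (a / 2 * t) * 2 * Real.exp (-(a * t)) := by
            gcongr
            exact hDb t
        _ = 2 * (2 / a) * (Real.exp (a / 2 * t) * Real.exp (-(a * t))) := by ring
        _ = _ := by rw [← Real.exp_add]; ring_nf)
  have hconv : expDamp a (posTrunc χ) ⋆[ContinuousLinearMap.mul ℂ ℂ] expDamp a D =
      expDamp a Y := funext fun t => convolution_expDamp a _ _ t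
  have hYsum : expDamp a Y = expDamp a (fun t => t * D t) + expDamp a R := by
    ext t
    simp only [Pi.add_apply, expDamp, hYe]
    rw [← Complex.ofReal_add]
    ring_nf
  have hY2 : MemLp (expDamp a Y) 2 := hYsum ▸ hψ2.add hR2
  have hYle := integral_norm_sq_convolution_le (M := M) hX1 hX2 hD1 (by rwa [hconv]) fun ξ => by
    rw [fourier_expDamp a hD0]
    exact hM _ (by simp)
  rw [hconv] at hYle
  have hsq : ∀ f : ℝ → ℝ, ∀ t, ‖expDamp a f t‖ ^ 2 = (f t * Real.exp (-(a * t))) ^ 2 := by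
    intro f t
    rw [norm_expDamp, mul_pow, mul_pow, sq_abs]
  have hψi := (memLp_two_iff_integrable_sq_norm hψ2.1).1 hψ2
  have hYi := (memLp_two_iff_integrable_sq_norm hY2.1).1 hY2
  have hRi := (memLp_two_iff_integrable_sq_norm hR2.1).1 hR2
  simp only [hsq] at hψi hYi hRi hYle hX3 hR3
  refine ⟨hψi, ?_⟩
  calc ∫ t, (t * D t * Real.exp (-(a * t))) ^ 2
      ≤ ∫ t, (2 * (Y t * Real.exp (-(a * t))) ^ 2 + 2 * (R t * Real.exp (-(a * t))) ^ 2) := by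
        refine integral_mono hψi ((hYi.const_mul 2).add (hRi.const_mul 2)) fun t => ?_
        simp only [hYe]
        nlinarith [sq_nonneg (Y t * Real.exp (-(a * t)) + R t * Real.exp (-(a * t)))]
    _ = 2 * (∫ t, (Y t * Real.exp (-(a * t))) ^ 2) +
          2 * ∫ t, (R t * Real.exp (-(a * t))) ^ 2 := by
        rw [integral_add (hYi.const_mul 2) (hRi.const_mul 2), integral_const_mul,
          integral_const_mul]
    _ ≤ 2 * (M ^ 2 * (1 ^ 2 / (2 * a))) + 2 * (δ ^ 2 / (2 * a)) := by
        gcongr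
        exact hYle.trans (by gcongr)
    _ = _ := by field_simp

/-! ### Increments of a solution -/

theorem IsSolution.intervalIntegrable_abs_increment {χ σ : ℝ → ℝ} (hχ : IsAdmissible χ)
    (hσ : IsSolution χ σ) (δ a b : ℝ) :
    IntervalIntegrable (fun t => |increment σ δ t|) volume a b := by
  rw [intervalIntegrable_iff]
  refine Measure.integrableOn_of_bounded (M := 2) (by simp)
    (hσ.measurable_increment δ).norm.aestronglyMeasurable (ae_of_all _ fun t => ?_)
  rw [Real.norm_eq_abs, abs_abs]
  exact hσ.abs_increment_le hχ δ t

/-- The `L¹` norm of the increment on a dyadic interval, from its weighted `L²` norm with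
`a = 1 / T`; the factor `T^{1/2}` lost in the Cauchy-Schwarz inequality compensates the factor
`a^{1/2}` in the norm of `χ e^{-at}`. -/
theorem exists_integral_dyadic_le : ∃ K : ℝ, 0 < K ∧ ∀ χ σ : ℝ → ℝ, IsAdmissible χ →
    IsSolution χ σ → ∀ δ T : ℝ, 0 < δ → δ ≤ T →
      ∫ t in T..2 * T, |increment σ δ t| ≤ K * δ * (T / δ) ^ (1 / Real.pi) := by
  obtain ⟨K, hK0, hK⟩ := exists_norm_laplace_increment_le
  refine ⟨Real.exp 2 * (K + 1), by positivity, fun χ σ hχ hσ δ T hδ hT => ?_⟩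
  have hT0 : 0 < T := hδ.trans_le hT
  set p := 1 / Real.pi
  have hp0 : 0 ≤ p := by have := Real.pi_pos; positivity
  have hone : 1 ≤ (T / δ) ^ p := Real.one_le_rpow (by rwa [one_le_div hδ]) hp0
  set M := K * δ * (T / δ) ^ p with hM
  have hM0 : 0 ≤ M := by positivity
  set A := M + δ with hA
  have hA0 : 0 < A := by positivity
  obtain ⟨hi, hle⟩ := hσ.integral_sq_mul_increment_le hχ hδ.le (a := 1 / T) (by positivity)
    fun s hs => hK χ σ hχ hσ δ T hδ hT s hs
  set g : ℝ → ℝ := fun t => (t * increment σ δ t * Real.exp (-(1 / T * t))) ^ 2 with hg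
  have hg0 : ∀ t, 0 ≤ g t := fun t => sq_nonneg _
  have hgA : ∫ t in T..2 * T, g t ≤ A ^ 2 * T := by
    rw [intervalIntegral.integral_of_le (by linarith)]
    refine (setIntegral_le_integral hi (ae_of_all _ hg0)).trans (hle.trans ?_)
    rw [div_div_eq_mul_div, div_one]
    gcongr
    nlinarith
  -- On `[T, 2T]` the weight `t e^{-t/T}` is at least `T e^{-2}`, and `2 |x| ≤ x² / A + A`.
  have hpt : ∀ t ∈ Icc T (2 * T),
      |increment σ δ t| ≤ Real.exp 2 / (2 * T) * (g t / A + A) := fun t ht => by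
    have ht0 : 0 < t := hT0.trans_le ht.1
    set x := |t * increment σ δ t * Real.exp (-(1 / T * t))| with hx
    have hgx : g t = x ^ 2 := by rw [hx, sq_abs]
    have h1 : 2 * x ≤ g t / A + A := by
      rw [hgx]
      have : x ^ 2 / A + A - 2 * x = (x - A) ^ 2 / A := by field_simp; ring
      have h2 : 0 ≤ (x - A) ^ 2 / A := by positivity
      linarith
    have h3 : T * |increment σ δ t| * Real.exp (-2) ≤ x := by
      rw [hx, abs_mul, abs_mul, abs_of_pos ht0, abs_of_pos (Real.exp_pos _)]
      gcongr
      · exact ht.1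
      · rw [div_mul_eq_mul_div, one_mul, div_le_iff₀ hT0]
        exact ht.2
    have h4 : |increment σ δ t| = Real.exp 2 / T * (T * |increment σ δ t| * Real.exp (-2)) := by
      rw [Real.exp_neg]
      field_simp
    rw [h4]
    calc _ ≤ Real.exp 2 / T * x := by gcongr
      _ = Real.exp 2 / (2 * T) * (2 * x) := by field_simp
      _ ≤ _ := by gcongr
  have hDi := hσ.intervalIntegrable_abs_increment hχ δ T (2 * T)
  have hgi : IntervalIntegrable g volume T (2 * T) := hi.intervalIntegrable
  calc ∫ t in T..2 * T, |increment σ δ t|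
      ≤ ∫ t in T..2 * T, Real.exp 2 / (2 * T) * (g t / A + A) :=
        intervalIntegral.integral_mono_on (by linarith) hDi
          (((hgi.div_const A).add intervalIntegrable_const).const_mul _) hpt
    _ = Real.exp 2 / (2 * T) * ((∫ t in T..2 * T, g t) / A + T * A) := by
        rw [intervalIntegral.integral_const_mul, intervalIntegral.integral_add
          (hgi.div_const A) intervalIntegrable_const, intervalIntegral.integral_div,
          intervalIntegral.integral_const, smul_eq_mul]
        ring
    _ ≤ Real.exp 2 / (2 * T) * (A ^ 2 * T / A + T * A) := by gcongr
    _ = Real.exp 2 * A := by field_simp; ring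
    _ ≤ Real.exp 2 * (M + δ * (T / δ) ^ p) := by
        refine mul_le_mul_of_nonneg_left (add_le_add le_rfl ?_) (Real.exp_pos _).le
        exact le_mul_of_one_le_right hδ.le hone
    _ = _ := by rw [hM]; ring

/-- Summing the dyadic estimates: since the bound at scale `T` grows like a positive power of `T`,
the sum is dominated by its last term. -/
theorem exists_integral_abs_increment_le : ∃ K : ℝ, 0 < K ∧ ∀ χ σ : ℝ → ℝ, IsAdmissible χ →
    IsSolution χ σ → ∀ δ T : ℝ, 0 < δ → δ ≤ T →
      ∫ t in (0 : ℝ)..T, |increment σ δ t| ≤ K * δ * (T / δ) ^ (1 / Real.pi) := by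
  obtain ⟨K, hK0, hK⟩ := exists_integral_dyadic_le
  set p := 1 / Real.pi
  have hp0 : 0 < p := by have := Real.pi_pos; positivity
  have h2p : 0 < (2 : ℝ) ^ p - 1 := sub_pos.2 (Real.one_lt_rpow one_lt_two hp0)
  -- `K'` is chosen so that `K' + K ≤ 2 ^ p * K'`, and so that `K' ≥ 4` covers `δ ≤ T ≤ 2 δ`.
  set K' := 4 + K / (2 ^ p - 1) with hK'
  have hK'0 : 0 < K' := by positivity
  have hstep : K' + K ≤ 2 ^ p * K' := by
    have : K = K / (2 ^ p - 1) * (2 ^ p - 1) := by field_simp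
    nlinarith
  refine ⟨K', hK'0, fun χ σ hχ hσ δ T hδ hT => ?_⟩
  have hi := hσ.intervalIntegrable_abs_increment hχ δ
  have main : ∀ n : ℕ, ∀ T, δ ≤ T → T ≤ 2 ^ n * δ →
      ∫ t in (0 : ℝ)..T, |increment σ δ t| ≤ K' * δ * (T / δ) ^ p := by
    have base : ∀ T, δ ≤ T → T ≤ 2 * δ →
        ∫ t in (0 : ℝ)..T, |increment σ δ t| ≤ K' * δ * (T / δ) ^ p := fun T h1 h2 => by
      have hT0 : 0 ≤ T := hδ.le.trans h1
      have hone : 1 ≤ (T / δ) ^ p := Real.one_le_rpow (by rwa [one_le_div hδ]) hp0.le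
      have hK4 : 4 ≤ K' := by
        have : 0 ≤ K / (2 ^ p - 1) := by positivity
        linarith
      calc ∫ t in (0 : ℝ)..T, |increment σ δ t| ≤ ∫ t in (0 : ℝ)..T, (2 : ℝ) :=
            intervalIntegral.integral_mono_on hT0 (hi _ _) intervalIntegrable_const
              fun t _ => hσ.abs_increment_le hχ δ t
        _ = 2 * T := by simp [mul_comm]
        _ ≤ 4 * δ * 1 := by linarith
        _ ≤ K' * δ * (T / δ) ^ p := by gcongr
    intro n
    induction n with
    | zero => exact fun T h1 h2 => base T h1 (by rw [pow_zero] at h2; linarith)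
    | succ n ih =>
      intro T h1 h2
      rcases le_or_gt T (2 * δ) with h | h
      · exact base T h1 h
      have hS1 : δ ≤ T / 2 := by linarith
      have hS2 : T / 2 ≤ 2 ^ n * δ := by rw [pow_succ] at h2; linarith
      have hd := hK χ σ hχ hσ δ (T / 2) hδ hS1
      rw [mul_div_cancel₀ T two_ne_zero] at hd
      have hsplit : T / δ = 2 * (T / 2 / δ) := by ring
      have hpos : 0 ≤ T / 2 / δ := div_nonneg (hδ.le.trans hS1) hδ.le
      rw [← intervalIntegral.integral_add_adjacent_intervals (hi 0 (T / 2)) (hi (T / 2) T),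
        hsplit, Real.mul_rpow zero_le_two hpos]
      have hr : 0 ≤ δ * (T / 2 / δ) ^ p := by positivity
      nlinarith [ih (T / 2) hS1 hS2]
  obtain ⟨n, hn⟩ := pow_unbounded_of_one_lt (T / δ) one_lt_two
  exact main n T hT (by rw [div_lt_iff₀ hδ] at hn; exact hn.le)

/-- The increment at `u` is controlled by the mean of the increments up to `u`. -/
theorem IsSolution.mul_abs_increment_le {χ σ : ℝ → ℝ} (hχ : IsAdmissible χ)
    (hσ : IsSolution χ σ) {δ u : ℝ} (hδ : 0 ≤ δ) (hu : 0 ≤ u) :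
    u * |increment σ δ u| ≤ (∫ t in (0 : ℝ)..u, |increment σ δ t|) + δ := by
  have hconv : |∫ r, posTrunc χ r * increment σ δ (u - r)| ≤
      ∫ t in (0 : ℝ)..u, |increment σ δ t| := by
    have e : ∫ t in (0 : ℝ)..u, |increment σ δ t| =
        ∫ r, (Ioc 0 u).indicator (fun r => |increment σ δ (u - r)|) r := by
      rw [integral_indicator measurableSet_Ioc, ← intervalIntegral.integral_of_le hu,
        intervalIntegral.integral_comp_sub_left (fun t => |increment σ δ t|)]
      simp
    rw [e, ← Real.norm_eq_abs]
    refine norm_integral_le_of_norm_le ?_ (ae_of_all _ fun r => ?_)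
    · rw [integrable_indicator_iff measurableSet_Ioc,
        ← intervalIntegrable_iff_integrableOn_Ioc_of_le hu]
      simpa using (hσ.intervalIntegrable_abs_increment hχ δ u 0).comp_sub_left u
    · rw [norm_mul, Real.norm_eq_abs, Real.norm_eq_abs]
      by_cases hr : r ∈ Ioc 0 u
      · rw [indicator_of_mem hr]
        exact mul_le_of_le_one_left (abs_nonneg _)
          (abs_posTrunc_le zero_le_one hχ.abs_le_one r)
      · rw [indicator_of_notMem hr]
        rcases le_or_gt r 0 with h0 | h0
        · simp [posTrunc_of_nonpos h0]
        · have : u < r := by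
            by_contra! h
            exact hr ⟨h0, h⟩
          simp [increment_of_nonpos hδ (show u - r ≤ 0 by linarith)]
  rw [← abs_of_nonneg hu, ← abs_mul, abs_of_nonneg hu, hσ.mul_increment_eq hχ]
  refine (abs_sub _ _).trans (add_le_add hconv ?_)
  rw [abs_mul, abs_of_nonneg hδ]
  exact mul_le_of_le_one_right hδ (hσ.abs_posTrunc_le_one hχ _)

theorem theorem4 :
    ∃ C : ℝ, 0 < C ∧ ∀ χ σ : ℝ → ℝ, IsAdmissible χ → IsSolution χ σ →
      ∀ u v : ℝ, 1 ≤ v → v ≤ u →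
        |σ u - σ v| ≤
          C * ((u - v) / u) ^ (1 - 1 / Real.pi) * (1 + Real.log (u / (u - v))) := by
  obtain ⟨K, hK0, hK⟩ := exists_integral_abs_increment_le
  refine ⟨K + 1, by positivity, fun χ σ hχ hσ u v hv huv => ?_⟩
  have hpi := Real.pi_gt_three
  -- For `v = u` division by zero and `log 0 = 0` make the last factor `1`, and the left side is `0`.
  rcases huv.eq_or_lt with rfl | hlt
  · simp only [sub_self, abs_zero, zero_div, div_zero, Real.log_zero, add_zero, mul_one]
    positivity
  set δ := u - v with hδ
  have hδ0 : 0 < δ := sub_pos.2 hlt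
  have hu : 0 < u := by linarith
  have hδu : δ ≤ u := by linarith
  set p := 1 / Real.pi with hp
  have hp0 : 0 ≤ p := by positivity
  have huδ : 1 ≤ u / δ := by rwa [one_le_div hδ0]
  have hinc : increment σ δ u = σ u - σ v := by
    rw [increment, posTrunc_of_pos hu, posTrunc_of_pos (by linarith), hδ, sub_sub_cancel]
  have hmain : u * |σ u - σ v| ≤ (K + 1) * δ * (u / δ) ^ p := by
    rw [← hinc]
    refine (hσ.mul_abs_increment_le hχ hδ0.le hu.le).trans ?_
    have h1 := hK χ σ hχ hσ δ u hδ0 hδu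
    have h2 : δ ≤ δ * (u / δ) ^ p := le_mul_of_one_le_right hδ0.le (Real.one_le_rpow huδ hp0)
    linarith
  have hpow : (δ / u) ^ (1 - p) = δ / u * (u / δ) ^ p := by
    rw [Real.rpow_sub (by positivity), Real.rpow_one, ← inv_div u δ, Real.inv_rpow (by positivity),
      div_inv_eq_mul]
  have hbound : |σ u - σ v| ≤ (K + 1) * (δ / u) ^ (1 - p) := by
    rw [hpow]
    refine le_of_mul_le_mul_left (hmain.trans (le_of_eq ?_)) hu
    field_simp
  refine hbound.trans (le_mul_of_one_le_right (by positivity) ?_)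
  linarith [Real.log_nonneg huδ]
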